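/- A function $f:\{-1,1\}^n\to\{-1,1\}$ is a $k$-junta if it depends only on at most $k$ of its $n$ input variables. Consider quantum algorithms that may adaptively perform arbitrary quantum operations and measurements on a finite-dimensional memory and have access to an unknown $f$ through two oracles: the classical membership oracle $\mathsf{MQ}(f)$, which on a classical query $x\in\{-1,1\}^n$ returns $f(x)$, and the quantum membership oracle $\mathsf{QMQ}(f)$, which acts on computational basis states by $|x,b\rangle\mapsto|x,b\cdot f(x)\rangle$ for $x\in\{-1,1\}^n$, $b\in\{-1,1\}$. Such an algorithm is a $1/10$-learning algorithm for $k$-juntas over $\{-1,1\}^n$ if for every $k$-junta $f$ it outputs, with probability at least $2/3$, a hypothesis $h:\{-1,1\}^n\to\{-1,1\}$ that agrees with $f$ on at least a $1-\frac1{10}$ fraction of the inputs in $\{-1,1\}^n$. Queries are counted in the worst case. There is an absolute constant $c>0$ such that for all integers $0\le k\le n$, every $1/10$-learning algorithm for $k$-juntas over $\{-1,1\}^n$ that uses at most $\frac{1}{101}2^k$ classical $\mathsf{MQ}$ queries must use at least $c\,2^k$ $\mathsf{QMQ}$ queries (that is, $\Omega(2^k)$ quantum queries in addition to the classical ones). 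-/

import Mathlib

open scoped Matrix

namespace JuntaLearning

/-- The Boolean cube `{-1,1}^n`; the two signs are the units of `ℤ`. -/
abbrev Cube (n : ℕ) : Type := Fin n → ℤˣ

/-- Boolean functions `{-1,1}^n → {-1,1}`. -/
abbrev BoolFn (n : ℕ) : Type := Cube n → ℤˣ

/-- `f` is a `k`-junta: it depends only on (at most) `k` of its `n` input variables. -/
def IsJunta {n : ℕ} (k : ℕ) (f : BoolFn n) : Prop :=
  ∃ S : Finset (Fin n), S.card ≤ k ∧ DependsOn f (S : Set (Fin n))

/-- `h` agrees with `f` on at least a `1 - ε` fraction of the inputs in `{-1,1}^n`. -/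
def IsAccurate {n : ℕ} (ε : ℝ) (f h : BoolFn n) : Prop :=
  1 - ε ≤ ((Finset.univ.filter fun x : Cube n => h x = f x).card : ℝ) / 2 ^ n

/-- Labels `(x, b, w)` of the computational basis states `|x, b, w⟩`: a query register
`x ∈ {-1,1}^n`, an answer register `b ∈ {-1,1}` and a `d`-dimensional workspace. -/
abbrev BasisLabel (n d : ℕ) : Type := Cube n × ℤˣ × Fin d

/-- (Not necessarily normalized) state vectors, as families of amplitudes. -/
abbrev StateVec (n d : ℕ) : Type := BasisLabel n d → ℂ

/-- The squared Euclidean norm of a state vector. -/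
noncomputable def normSq {n d : ℕ} (ψ : StateVec n d) : ℝ := ∑ z, ‖ψ z‖ ^ 2

/-- The quantum membership oracle `QMQ(f)`, i.e. the linear map which sends the basis state
`|x, b, w⟩` to `|x, b * f x, w⟩` (see `qmqOracle_single`). -/
def qmqOracle {n d : ℕ} (f : BoolFn n) (ψ : StateVec n d) : StateVec n d :=
  fun z => ψ (z.1, z.2.1 * f z.1, z.2.2)

theorem qmqOracle_single {n d : ℕ} (f : BoolFn n) (x : Cube n) (b : ℤˣ) (w : Fin d) :
    qmqOracle f (Pi.single (x, b, w) 1) = Pi.single (x, b * f x, w) 1 := by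
  funext ⟨y, c, v⟩
  have h : ((y, c * f y, v) = (x, b, w)) ↔ ((y, c, v) = (x, b * f x, w)) := by
    simp only [Prod.mk.injEq]
    constructor
    · rintro ⟨rfl, rfl, rfl⟩
      simp [mul_assoc, Int.units_mul_self]
    · rintro ⟨rfl, rfl, rfl⟩
      simp [mul_assoc, Int.units_mul_self]
  simp only [qmqOracle, Pi.single_apply, h]

/-- Adaptive programs with access to a classical and a quantum membership oracle, acting on a
quantum memory spanned by the states `|x, b, w⟩`, with classical control.

* `halt h`: stop and output the hypothesis `h`.
* `instr m K hK next`: perform the quantum operation with `m` classical outcomes and Kraus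
  operators `K i` (a unitary if `m = 1`; projective measurements and coin tosses are special
  cases), and go on with `next i` if the outcome is `i`.
* `qmq next`: one query to `QMQ(f)`, then go on with `next`.
* `mq x next`: one query to `MQ(f)` on the classical input `x`, then go on with `next (f x)`. -/
inductive Program (n d : ℕ) : Type
  | halt (h : BoolFn n) : Program n d
  | instr (m : ℕ) (K : Fin m → Matrix (BasisLabel n d) (BasisLabel n d) ℂ)
      (hK : ∑ i, (K i)ᴴ * K i = 1) (next : Fin m → Program n d) : Program n d
  | qmq (next : Program n d) : Program n d
  | mq (x : Cube n) (next : ℤˣ → Program n d) : Program n d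

namespace Program

variable {n d : ℕ}

/-- Number of classical membership queries in the worst case, i.e. on any branch. -/
def mqCount : Program n d → ℕ
  | halt _ => 0
  | instr _ _ _ next => Finset.univ.sup fun i => (next i).mqCount
  | qmq next => next.mqCount
  | mq _ next => 1 + Finset.univ.sup fun b => (next b).mqCount

/-- Number of quantum membership queries in the worst case, i.e. on any branch. -/
def qmqCount : Program n d → ℕ
  | halt _ => 0
  | instr _ _ _ next => Finset.univ.sup fun i => (next i).qmqCount
  | qmq next => 1 + next.qmqCount
  | mq _ next => Finset.univ.sup fun b => (next b).qmqCount

/-- `outputProb f h P ψ` is the probability that `P`, run with oracles for `f` on the memory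
state `ψ`, outputs `h`. After a measurement the state is not renormalized: the squared norm of
the state is the probability of the branch, starting from a unit vector (Born rule). -/
noncomputable def outputProb (f h : BoolFn n) : Program n d → StateVec n d → ℝ
  | halt h', ψ => if h' = h then normSq ψ else 0
  | instr _ K _ next, ψ => ∑ i, (next i).outputProb f h (K i *ᵥ ψ)
  | qmq next, ψ => next.outputProb f h (qmqOracle f ψ)
  | mq x next, ψ => (next (f x)).outputProb f h ψ

end Program

/-- A quantum algorithm for functions on `{-1,1}^n` with access to `MQ` and `QMQ`: the dimension
of its workspace, the initial state of its memory (a unit vector), and its program. -/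
structure Algorithm (n : ℕ) where
  workDim : ℕ
  init : StateVec n workDim
  init_unit : normSq init = 1
  program : Program n workDim

namespace Algorithm

variable {n : ℕ}

/-- Worst-case number of classical membership queries. -/
def mqCount (A : Algorithm n) : ℕ := A.program.mqCount

/-- Worst-case number of quantum membership queries. -/
def qmqCount (A : Algorithm n) : ℕ := A.program.qmqCount

/-- Probability that the algorithm outputs the hypothesis `h` when the target is `f`. -/
noncomputable def outputProb (A : Algorithm n) (f h : BoolFn n) : ℝ :=
  A.program.outputProb f h A.init

open scoped Classical in
/-- `A` is an `ε`-learning algorithm for the class `C` under the uniform distribution: for every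
target `f ∈ C` it outputs, with probability at least `2/3`, a hypothesis which agrees with `f` on
at least a `1 - ε` fraction of the inputs. -/
def IsLearner (A : Algorithm n) (ε : ℝ) (C : Set (BoolFn n)) : Prop :=
  ∀ f ∈ C, (2 / 3 : ℝ) ≤
    ∑ h ∈ Finset.univ.filter (fun h : BoolFn n => IsAccurate ε f h), A.outputProb f h

end Algorithm

end JuntaLearning

/-!
Fix a set `S` of `k` variables and let the target be `g ∘ S.restrict` for a uniformly random
`g : {-1,1}^S → {-1,1}`, a string of `N = 2 ^ k` signs.

By the polynomial method, an algorithm with `q` quantum and `m` classical queries outputs any given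
hypothesis with a probability that is a polynomial in these signs of degree at most
`D = 2 * q + m`. The Fourier expansion bounds a nonnegative polynomial of degree `D` pointwise by
its mean times the number `C` of monomials of degree at most `D`. Hence, if every hypothesis is
accurate for at most `B` targets, then the average success probability is at most `B * C / 2 ^ N`.

A Chernoff argument gives `B ≤ (25 / 18) ^ N`, and `50 * D ≤ N` would give `C ≤ (9 / 8) ^ N`, which
is incompatible with success probability `2 / 3`.
-/

namespace JuntaLearning

open Finset

section LowDegree

variable {Y : Type*}

/-- The Fourier character of the cube `Y → {-1,1}` indexed by `S`, i.e. the monomial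
`∏ y ∈ S, g y` with complex values. -/
def character (S : Finset Y) : (Y → ℤˣ) →* ℂ where
  toFun g := ((∏ y ∈ S, g y : ℤˣ) : ℤ)
  map_one' := by simp
  map_mul' g g' := by simp [prod_mul_distrib]

theorem character_apply (S : Finset Y) (g : Y → ℤˣ) :
    character S g = ((∏ y ∈ S, g y : ℤˣ) : ℤ) := rfl

theorem norm_character (S : Finset Y) (g : Y → ℤˣ) : ‖character S g‖ = 1 := by
  rcases Int.units_eq_one_or (∏ y ∈ S, g y) with h | h <;> simp [character_apply, h]

theorem star_character (S : Finset Y) : star ⇑(character S) = character S := by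
  funext g
  simp [character_apply]

theorem character_mul_character [DecidableEq Y] (S T : Finset Y) :
    character S * character T = character (symmDiff S T) := by
  have hprod (g : Y → ℤˣ) : (∏ y ∈ S, g y) * ∏ y ∈ T, g y = ∏ y ∈ symmDiff S T, g y := by
    rw [← prod_union_inter, ← sup_eq_union, ← inf_eq_inter, ← symmDiff_sup_inf S T, sup_eq_union,
      prod_union (disjoint_symmDiff_inf S T), mul_assoc, Int.units_mul_self, mul_one]
  ext g
  simp only [MonoidHom.mul_apply, character_apply, ← hprod, Units.val_mul, Int.cast_mul]

theorem character_eq_one_iff {S : Finset Y} : character S = 1 ↔ S = ∅ := by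
  classical
  refine ⟨fun h => by_contra fun hS => ?_, ?_⟩
  · obtain ⟨y, hy⟩ := nonempty_iff_ne_empty.mpr hS
    have hflip := DFunLike.congr_fun h (Pi.mulSingle y (-1))
    norm_num [character_apply, prod_pi_mulSingle, hy] at hflip
  · rintro rfl
    ext g
    simp [character_apply]

theorem sum_character_mul_character [Fintype Y] [DecidableEq Y] (S T : Finset Y) :
    ∑ g, character S g * character T g = if S = T then 2 ^ Fintype.card Y else 0 := by
  classical
  simp only [← MonoidHom.mul_apply, character_mul_character]
  simp [sum_hom_units, character_eq_one_iff, ← bot_eq_empty, symmDiff_eq_bot]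

/-- The complex-valued functions on the cube `Y → {-1,1}` that are polynomials of degree at most
`D` in the coordinates, encoded as combinations of multilinear monomials since `(g y) ^ 2 = 1`. -/
def lowDegree (Y : Type*) (D : ℕ) : Submodule ℂ ((Y → ℤˣ) → ℂ) :=
  Submodule.span ℂ ((fun S => ⇑(character S)) '' {S : Finset Y | #S ≤ D})

theorem lowDegree_mono {D E : ℕ} (h : D ≤ E) : lowDegree Y D ≤ lowDegree Y E :=
  Submodule.span_mono (Set.image_mono fun _ hS => le_trans hS h)

theorem character_mem_lowDegree (S : Finset Y) : ⇑(character S) ∈ lowDegree Y #S :=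
  Submodule.subset_span ⟨S, le_refl #S, rfl⟩

theorem const_mem_lowDegree (c : ℂ) (D : ℕ) : (fun _ => c) ∈ lowDegree Y D := by
  have h : (fun _ => c) = c • ⇑(character (∅ : Finset Y)) := by
    funext g
    simp [character_apply]
  rw [h]
  exact Submodule.smul_mem _ _ (lowDegree_mono D.zero_le (character_mem_lowDegree ∅))

theorem star_mem_lowDegree {D : ℕ} {p : (Y → ℤˣ) → ℂ} (hp : p ∈ lowDegree Y D) :
    star p ∈ lowDegree Y D := by
  induction hp using Submodule.span_induction with
  | mem p hp =>
    obtain ⟨S, hS, rfl⟩ := hp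
    exact Submodule.subset_span ⟨S, hS, (star_character S).symm⟩
  | zero => simp
  | add p q _ _ hp hq => rw [star_add]; exact Submodule.add_mem _ hp hq
  | smul c p _ hp => rw [star_smul]; exact Submodule.smul_mem _ _ hp

theorem mul_mem_lowDegree {D E : ℕ} {p q : (Y → ℤˣ) → ℂ} (hp : p ∈ lowDegree Y D)
    (hq : q ∈ lowDegree Y E) : p * q ∈ lowDegree Y (D + E) := by
  classical
  have h := Submodule.mul_mem_mul hp hq
  rw [lowDegree, lowDegree, Submodule.span_mul_span] at h
  refine Submodule.span_mono ?_ h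
  rintro _ ⟨_, ⟨S, hS, rfl⟩, _, ⟨T, hT, rfl⟩, rfl⟩
  refine ⟨symmDiff S T, ?_, congrArg DFunLike.coe (character_mul_character S T).symm⟩
  calc #(symmDiff S T) ≤ #(S ∪ T) := card_le_card symmDiff_le_sup
    _ ≤ #S + #T := card_union_le S T
    _ ≤ D + E := add_le_add hS hT

theorem branch_mem_lowDegree {D : ℕ} (y : Y) {p : ℤˣ → (Y → ℤˣ) → ℂ}
    (hp : ∀ b, p b ∈ lowDegree Y D) : (fun g => p (g y) g) ∈ lowDegree Y (D + 1) := by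
  have h : (fun g => p (g y) g) = (1 / 2 : ℂ) • (p 1 + p (-1)) +
      (1 / 2 : ℂ) • ((p 1 - p (-1)) * ⇑(character {y})) := by
    funext g
    rcases Int.units_eq_one_or (g y) with h | h <;> simp [character_apply, h] <;> ring
  rw [h]
  refine Submodule.add_mem _ (Submodule.smul_mem _ _ ?_) (Submodule.smul_mem _ _ ?_)
  · exact lowDegree_mono D.le_succ (Submodule.add_mem _ (hp 1) (hp (-1)))
  · exact mul_mem_lowDegree (Submodule.sub_mem _ (hp 1) (hp (-1))) (character_mem_lowDegree {y})

variable [Fintype Y]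

/-- The number of multilinear monomials of degree at most `D` in the variables `Y`, i.e. the
dimension of `lowDegree Y D`. -/
def monomialCount (Y : Type*) [Fintype Y] (D : ℕ) : ℕ := #{S : Finset Y | #S ≤ D}

theorem monomialCount_mul_pow_le {q D : ℕ} (hD : q * D ≤ Fintype.card Y) {u : ℝ} (hu₀ : 0 ≤ u)
    (hu₁ : u ≤ 1) :
    monomialCount Y D * u ^ Fintype.card Y ≤ (1 + u ^ q) ^ Fintype.card Y := by
  have hgen : ∑ S : Finset Y, (u ^ q) ^ #S = (1 + u ^ q) ^ Fintype.card Y := by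
    simpa [add_comm] using Fintype.sum_pow_mul_eq_add_pow Y (u ^ q) 1
  have hterm (S : Finset Y) (hS : #S ≤ D) : u ^ Fintype.card Y ≤ (u ^ q) ^ #S := by
    rw [← pow_mul]
    exact pow_le_pow_of_le_one hu₀ hu₁ ((Nat.mul_le_mul_left q hS).trans hD)
  calc monomialCount Y D * u ^ Fintype.card Y
      = ∑ S : Finset Y with #S ≤ D, u ^ Fintype.card Y := by simp [monomialCount]
    _ ≤ ∑ S : Finset Y with #S ≤ D, (u ^ q) ^ #S :=
        sum_le_sum fun S hS => hterm S (mem_filter.mp hS).2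
    _ ≤ ∑ S : Finset Y, (u ^ q) ^ #S :=
        sum_le_sum_of_subset_of_nonneg (filter_subset _ _) fun _ _ _ => by positivity
    _ = (1 + u ^ q) ^ Fintype.card Y := hgen

theorem monomialCount_le_of_fifty_mul_le {D : ℕ} (hD : 50 * D ≤ Fintype.card Y) :
    monomialCount Y D ≤ (9 / 8 : ℝ) ^ Fintype.card Y := by
  have hcount := monomialCount_mul_pow_le hD (u := 10 / 11) (by norm_num) (by norm_num)
  rw [← le_div_iff₀ (by positivity), ← div_pow] at hcount
  refine hcount.trans (pow_le_pow_left₀ (by positivity) ?_ _)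
  norm_num

variable [DecidableEq Y]

theorem sum_character_kernel_mul {D : ℕ} {p : (Y → ℤˣ) → ℂ} (hp : p ∈ lowDegree Y D)
    (g : Y → ℤˣ) :
    ∑ g', (∑ S : Finset Y with #S ≤ D, character S g * character S g') * p g' =
      2 ^ Fintype.card Y * p g := by
  induction hp using Submodule.span_induction with
  | mem p hp =>
    obtain ⟨T, hT, rfl⟩ := hp
    have hcard : #T ≤ D := hT
    simp only [sum_mul]
    rw [sum_comm]
    simp only [mul_assoc, ← mul_sum, sum_character_mul_character, mul_ite, mul_zero]
    simp [hcard, mul_comm]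
  | zero => simp
  | add p q _ _ hp hq => simp only [Pi.add_apply, mul_add, sum_add_distrib, hp, hq]
  | smul c p _ hp => simp only [Pi.smul_apply, smul_eq_mul, mul_left_comm _ c, ← mul_sum, hp]

theorem norm_le_monomialCount_mul_mean {D : ℕ} {p : (Y → ℤˣ) → ℂ} (hp : p ∈ lowDegree Y D)
    (g : Y → ℤˣ) : ‖p g‖ ≤ monomialCount Y D * ((∑ g', ‖p g'‖) / 2 ^ Fintype.card Y) := by
  have hkernel (g' : Y → ℤˣ) :
      ‖∑ S : Finset Y with #S ≤ D, character S g * character S g'‖ ≤ monomialCount Y D :=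
    (norm_sum_le _ _).trans_eq (by simp [norm_character, monomialCount])
  rw [← mul_div_assoc, le_div_iff₀ (by positivity)]
  calc ‖p g‖ * 2 ^ Fintype.card Y
      = ‖∑ g', (∑ S : Finset Y with #S ≤ D, character S g * character S g') * p g'‖ := by
        rw [sum_character_kernel_mul hp]
        simp [mul_comm]
    _ ≤ ∑ g', monomialCount Y D * ‖p g'‖ := norm_sum_le_of_le _ fun g' _ => by
        rw [norm_mul]
        gcongr
        exact hkernel g'
    _ = monomialCount Y D * ∑ g', ‖p g'‖ := by rw [mul_sum]

/-- Read `p h g` as the probability of answering `h` on input `g`, and `R g h` as `h` being an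
acceptable answer for `g`. -/
theorem mul_two_pow_card_le_mul_monomialCount {H : Type*} [Fintype H] {D B : ℕ} {δ : ℝ}
    {p : H → (Y → ℤˣ) → ℝ} (hp : ∀ h, (fun g => (p h g : ℂ)) ∈ lowDegree Y D)
    (hp_nonneg : ∀ h g, 0 ≤ p h g) (hp_sum : ∀ g, ∑ h, p h g ≤ 1)
    (R : (Y → ℤˣ) → H → Prop) [∀ g h, Decidable (R g h)] (hB : ∀ h, #{g | R g h} ≤ B)
    (hδ : ∀ g, δ ≤ ∑ h with R g h, p h g) :
    δ * 2 ^ Fintype.card Y ≤ B * monomialCount Y D := by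
  have hmean (h : H) (g : Y → ℤˣ) :
      p h g ≤ monomialCount Y D * ((∑ g', p h g') / 2 ^ Fintype.card Y) := by
    simpa [abs_of_nonneg (hp_nonneg _ _)] using norm_le_monomialCount_mul_mean (hp h) g
  have hmean_nonneg (h : H) : 0 ≤ (∑ g', p h g') / 2 ^ Fintype.card Y :=
    div_nonneg (sum_nonneg fun g _ => hp_nonneg h g) (by positivity)
  have htotal : ∑ h, (∑ g, p h g) / 2 ^ Fintype.card Y ≤ 1 := by
    rw [← sum_div, sum_comm, div_le_one (by positivity)]
    exact (sum_le_sum fun g _ => hp_sum g).trans_eq (by simp)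
  calc δ * 2 ^ Fintype.card Y = ∑ _g : Y → ℤˣ, δ := by simp [mul_comm]
    _ ≤ ∑ g, ∑ h with R g h, p h g := sum_le_sum fun g _ => hδ g
    _ = ∑ h, ∑ g with R g h, p h g := by
        simp only [sum_filter]
        exact sum_comm
    _ ≤ ∑ h, B * (monomialCount Y D * ((∑ g', p h g') / 2 ^ Fintype.card Y)) :=
        sum_le_sum fun h _ => (sum_le_card_nsmul _ _ _ fun g _ => hmean h g).trans <| by
          rw [nsmul_eq_mul]
          have := hmean_nonneg h
          gcongr
          exact hB h
    _ = B * monomialCount Y D * ∑ h, (∑ g', p h g') / 2 ^ Fintype.card Y := by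
        simp only [mul_sum, mul_assoc]
    _ ≤ B * monomialCount Y D := mul_le_of_le_one_right (by positivity) htotal

end LowDegree

section StateVec

variable {n d : ℕ}

theorem normSq_nonneg (ψ : StateVec n d) : 0 ≤ normSq ψ :=
  sum_nonneg fun _ _ => by positivity

theorem ofReal_normSq (ψ : StateVec n d) : (normSq ψ : ℂ) = star ψ ⬝ᵥ ψ := by
  simp [normSq, dotProduct, Complex.conj_mul']

theorem normSq_qmqOracle (f : BoolFn n) (ψ : StateVec n d) :
    normSq (qmqOracle f ψ) = normSq ψ := by
  simp only [normSq, qmqOracle, Fintype.sum_prod_type]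
  refine sum_congr rfl fun x _ => ?_
  exact Equiv.sum_comp (Equiv.mulRight (f x)) fun b => ∑ w, ‖ψ (x, b, w)‖ ^ 2

theorem sum_normSq_mulVec {ι : Type*} [Fintype ι]
    {K : ι → Matrix (BasisLabel n d) (BasisLabel n d) ℂ} (hK : ∑ i, (K i)ᴴ * K i = 1)
    (ψ : StateVec n d) : ∑ i, normSq (K i *ᵥ ψ) = normSq ψ := by
  have h : ((∑ i, normSq (K i *ᵥ ψ) : ℝ) : ℂ) = (normSq ψ : ℂ) := by
    push_cast
    simp only [ofReal_normSq, Matrix.star_mulVec, ← Matrix.dotProduct_mulVec,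
      Matrix.mulVec_mulVec]
    rw [← dotProduct_sum, ← Matrix.sum_mulVec, hK, Matrix.one_mulVec]
  exact_mod_cast h

variable {Y : Type*} {a : ℕ} {ψ : (Y → ℤˣ) → StateVec n d}

theorem normSq_mem_lowDegree (hψ : ∀ z, (fun g => ψ g z) ∈ lowDegree Y a) :
    (fun g => (normSq (ψ g) : ℂ)) ∈ lowDegree Y (2 * a) := by
  have h : (fun g => (normSq (ψ g) : ℂ)) = ∑ z, star (fun g => ψ g z) * fun g => ψ g z := by
    funext g
    simp [ofReal_normSq, dotProduct]
  rw [h, two_mul]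
  exact Submodule.sum_mem _ fun z _ => mul_mem_lowDegree (star_mem_lowDegree (hψ z)) (hψ z)

theorem mulVec_mem_lowDegree (hψ : ∀ z, (fun g => ψ g z) ∈ lowDegree Y a)
    (K : Matrix (BasisLabel n d) (BasisLabel n d) ℂ) (z : BasisLabel n d) :
    (fun g => (K *ᵥ ψ g) z) ∈ lowDegree Y a := by
  have h : (fun g => (K *ᵥ ψ g) z) = ∑ z', K z z' • fun g => ψ g z' := by
    funext g
    simp [Matrix.mulVec, dotProduct]
  rw [h]
  exact Submodule.sum_mem _ fun z' _ => Submodule.smul_mem _ _ (hψ z')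

theorem qmqOracle_comp_mem_lowDegree (hψ : ∀ z, (fun g => ψ g z) ∈ lowDegree Y a)
    (π : Cube n → Y) (z : BasisLabel n d) :
    (fun g => qmqOracle (g ∘ π) (ψ g) z) ∈ lowDegree Y (a + 1) :=
  branch_mem_lowDegree (π z.1) (p := fun b g => ψ g (z.1, z.2.1 * b, z.2.2)) fun _ => hψ _

end StateVec

namespace Program

variable {n d : ℕ}

theorem outputProb_nonneg (f h : BoolFn n) (P : Program n d) (ψ : StateVec n d) :
    0 ≤ P.outputProb f h ψ := by
  induction P generalizing ψ with
  | halt h' =>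
    rw [outputProb]
    split_ifs
    exacts [normSq_nonneg ψ, le_rfl]
  | instr m K _ _ ih => exact sum_nonneg fun i _ => ih i _
  | qmq _ ih => exact ih _
  | mq x _ ih => exact ih _ _

theorem sum_outputProb (f : BoolFn n) (P : Program n d) (ψ : StateVec n d) :
    ∑ h, P.outputProb f h ψ = normSq ψ := by
  induction P generalizing ψ with
  | halt h' => simp [outputProb]
  | instr m K hK _ ih =>
    simp only [outputProb]
    rw [sum_comm]
    simp only [ih]
    exact sum_normSq_mulVec hK ψ
  | qmq _ ih => simp only [outputProb, ih, normSq_qmqOracle]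
  | mq x _ ih => simp only [outputProb, ih]

/-- Each quantum query raises the degree of the amplitudes by one, hence that of the probabilities
by two. -/
theorem outputProb_comp_mem_lowDegree {Y : Type*} (π : Cube n → Y) (h : BoolFn n)
    (P : Program n d) {a : ℕ} {ψ : (Y → ℤˣ) → StateVec n d}
    (hψ : ∀ z, (fun g => ψ g z) ∈ lowDegree Y a) :
    (fun g => (P.outputProb (g ∘ π) h (ψ g) : ℂ)) ∈
      lowDegree Y (2 * a + 2 * P.qmqCount + P.mqCount) := by
  induction P generalizing a ψ with
  | halt h' =>
    simp only [outputProb]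
    split_ifs
    · exact normSq_mem_lowDegree hψ
    · exact const_mem_lowDegree _ _
  | instr m K hK next ih =>
    have hsum : (fun g => ((instr m K hK next).outputProb (g ∘ π) h (ψ g) : ℂ)) =
        ∑ i, fun g => ((next i).outputProb (g ∘ π) h (K i *ᵥ ψ g) : ℂ) := by
      funext g
      simp [outputProb]
    rw [hsum]
    refine Submodule.sum_mem _ fun i _ =>
      lowDegree_mono ?_ (ih i (mulVec_mem_lowDegree hψ (K i)))
    simp only [qmqCount, mqCount]
    gcongr
    · exact le_sup (f := fun i => (next i).qmqCount) (mem_univ i)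
    · exact le_sup (f := fun i => (next i).mqCount) (mem_univ i)
  | qmq next ih =>
    refine lowDegree_mono ?_ (ih (qmqOracle_comp_mem_lowDegree hψ π))
    simp only [qmqCount, mqCount]
    lia
  | mq x next ih =>
    have hbranch (b : ℤˣ) : (fun g => ((next b).outputProb (g ∘ π) h (ψ g) : ℂ)) ∈
        lowDegree Y (2 * a + 2 * (mq x next).qmqCount + univ.sup fun b => (next b).mqCount) := by
      refine lowDegree_mono ?_ (ih b hψ)
      simp only [qmqCount]
      gcongr
      · exact le_sup (f := fun b => (next b).qmqCount) (mem_univ b)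
      · exact le_sup (f := fun b => (next b).mqCount) (mem_univ b)
    refine lowDegree_mono ?_ (branch_mem_lowDegree (π x) hbranch)
    simp only [mqCount]
    lia

end Program

namespace Algorithm

variable {n : ℕ}

theorem outputProb_nonneg (A : Algorithm n) (f h : BoolFn n) : 0 ≤ A.outputProb f h :=
  A.program.outputProb_nonneg f h A.init

theorem sum_outputProb (A : Algorithm n) (f : BoolFn n) : ∑ h, A.outputProb f h = 1 :=
  (A.program.sum_outputProb f A.init).trans A.init_unit

theorem outputProb_comp_mem_lowDegree {Y : Type*} (A : Algorithm n) (π : Cube n → Y)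
    (h : BoolFn n) :
    (fun g => (A.outputProb (g ∘ π) h : ℂ)) ∈ lowDegree Y (2 * A.qmqCount + A.mqCount) := by
  simpa [Algorithm.outputProb, Algorithm.qmqCount, Algorithm.mqCount] using
    A.program.outputProb_comp_mem_lowDegree π h (a := 0) fun z => const_mem_lowDegree (A.init z) 0

open scoped Classical in
theorem IsLearner.two_thirds_mul_le {A : Algorithm n} {ε : ℝ} {C : Set (BoolFn n)}
    (hA : A.IsLearner ε C) {Y : Type*} [Fintype Y] [DecidableEq Y] (π : Cube n → Y)
    (hC : ∀ g : Y → ℤˣ, g ∘ π ∈ C) {B : ℕ}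
    (hB : ∀ h, #{g : Y → ℤˣ | IsAccurate ε (g ∘ π) h} ≤ B) :
    2 / 3 * 2 ^ Fintype.card Y ≤ (B * monomialCount Y (2 * A.qmqCount + A.mqCount) : ℝ) :=
  mul_two_pow_card_le_mul_monomialCount (A.outputProb_comp_mem_lowDegree π)
    (fun h g => A.outputProb_nonneg (g ∘ π) h) (fun g => (A.sum_outputProb (g ∘ π)).le)
    (fun g h => IsAccurate ε (g ∘ π) h) hB fun g => hA _ (hC g)

end Algorithm

section Counting

theorem pow_add_pow_le_one_add_pow {s : ℝ} (hs₀ : 0 ≤ s) (hs₁ : s ≤ 1) (i j : ℕ) :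
    s ^ i + s ^ j ≤ 1 + s ^ (i + j) := by
  rw [pow_add]
  nlinarith [mul_nonneg (sub_nonneg.mpr (pow_le_one₀ hs₀ hs₁ : s ^ i ≤ 1))
    (sub_nonneg.mpr (pow_le_one₀ hs₀ hs₁ : s ^ j ≤ 1))]

theorem card_filter_ne_one_add_card_filter_ne_neg_one {X : Type*} (F : Finset X) (h : X → ℤˣ) :
    #{x ∈ F | h x ≠ 1} + #{x ∈ F | h x ≠ -1} = #F := by
  rw [← card_filter_add_card_filter_not (s := F) fun x => h x ≠ 1]
  congr 2
  ext x
  rcases Int.units_eq_one_or (h x) with hx | hx <;> simp [hx]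

variable {X Y : Type*} [Fintype X] [Fintype Y] [DecidableEq Y]

theorem hammingDist_comp_eq_sum {β : Type*} [DecidableEq β] (π : X → Y) (h : X → β) (g : Y → β) :
    hammingDist h (g ∘ π) = ∑ y, #{x ∈ ({x | π x = y} : Finset X) | h x ≠ g y} := by
  rw [hammingDist, card_eq_sum_card_fiberwise (f := π) (t := univ) fun _ _ => mem_univ _]
  refine sum_congr rfl fun y _ => congrArg card ?_
  ext x
  simp only [mem_filter, mem_univ, true_and, Function.comp_apply]
  constructor
  · rintro ⟨hx, rfl⟩
    exact ⟨rfl, hx⟩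
  · rintro ⟨rfl, hx⟩
    exact ⟨hx, rfl⟩

/-- The exponential moment of the distance is a product over the fibres of `π`, and a fibre of size
`M` contributes most if `h` is constant on it. -/
theorem sum_pow_hammingDist_comp_le {π : X → Y} {M : ℕ}
    (hπ : ∀ y, #{x | π x = y} = M) (h : X → ℤˣ) {s : ℝ} (hs₀ : 0 ≤ s) (hs₁ : s ≤ 1) :
    ∑ g : Y → ℤˣ, s ^ hammingDist h (g ∘ π) ≤ (1 + s ^ M) ^ Fintype.card Y := by
  have hfibre (y : Y) :
      ∑ b : ℤˣ, s ^ #{x ∈ ({x | π x = y} : Finset X) | h x ≠ b} ≤ 1 + s ^ M := by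
    rw [← hπ y, ← card_filter_ne_one_add_card_filter_ne_neg_one _ h,
      show (univ : Finset ℤˣ) = {1, -1} from rfl, sum_pair (by decide)]
    exact pow_add_pow_le_one_add_pow hs₀ hs₁ _ _
  calc ∑ g : Y → ℤˣ, s ^ hammingDist h (g ∘ π)
      = ∑ g : Y → ℤˣ, ∏ y, s ^ #{x ∈ ({x | π x = y} : Finset X) | h x ≠ g y} := by
        simp only [hammingDist_comp_eq_sum, prod_pow_eq_pow_sum]
    _ = ∏ y, ∑ b : ℤˣ, s ^ #{x ∈ ({x | π x = y} : Finset X) | h x ≠ b} :=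
        (Fintype.prod_sum fun y b => s ^ #{x ∈ ({x | π x = y} : Finset X) | h x ≠ b}).symm
    _ ≤ ∏ _y : Y, (1 + s ^ M) := prod_le_prod (fun _ _ => by positivity) fun y _ => hfibre y
    _ = (1 + s ^ M) ^ Fintype.card Y := by simp

end Counting

section Junta

variable {n k : ℕ} {S : Finset (Fin n)}

theorem isJunta_comp_restrict (hS : #S ≤ k) (g : (S → ℤˣ) → ℤˣ) : IsJunta k (g ∘ S.restrict) :=
  ⟨S, hS, fun _ _ hxy => congrArg g (S.dependsOn_restrict hxy)⟩

theorem card_filter_restrict_eq (y : S → ℤˣ) :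
    #{x : Cube n | S.restrict x = y} = 2 ^ (n - #S) := by
  rw [← Fintype.card_subtype]
  exact (Fintype.card_congr (Equiv.subtypePreimage (· ∈ S) y)).trans (by simp)

theorem isAccurate_iff_hammingDist_le {ε : ℝ} {f h : BoolFn n} :
    IsAccurate ε f h ↔ (hammingDist h f : ℝ) ≤ ε * 2 ^ n := by
  have hcard : (#{x | h x = f x} : ℝ) + hammingDist h f = 2 ^ n := by
    have := card_filter_add_card_filter_not (s := univ) fun x => h x = f x
    exact_mod_cast this.trans (by simp)
  rw [IsAccurate, le_div_iff₀ (by positivity)]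
  constructor <;> intro <;> linarith

open scoped Classical in
theorem card_isAccurate_restrict_mul_le (h : BoolFn n) (ε : ℝ) {t : ℝ} (ht₀ : 0 < t)
    (ht₁ : t ≤ 1) :
    #{g : (S → ℤˣ) → ℤˣ | IsAccurate ε (g ∘ S.restrict) h} * (t ^ ε) ^ 2 ^ #S ≤
      (1 + t) ^ 2 ^ #S := by
  set M := 2 ^ (n - #S) with hM
  set s := t ^ (M⁻¹ : ℝ)
  have hs_pow : s ^ M = t := Real.rpow_inv_natCast_pow ht₀.le (by positivity)
  have hs₀ : 0 < s := Real.rpow_pos_of_pos ht₀ _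
  have hs₁ : s ≤ 1 := Real.rpow_le_one ht₀.le ht₁ (by positivity)
  have hn : (M : ℝ) * 2 ^ #S = 2 ^ n := by
    have hle : #S ≤ n := by simpa using S.card_le_univ
    rw [hM]
    push_cast
    rw [← pow_add, Nat.sub_add_cancel hle]
  have hradius : (t ^ ε) ^ 2 ^ #S = s ^ (ε * 2 ^ n : ℝ) := by
    rw [← hs_pow, ← Real.rpow_natCast s, ← Real.rpow_mul hs₀.le, ← Real.rpow_mul_natCast hs₀.le,
      ← hn]
    push_cast
    ring_nf
  calc #{g : (S → ℤˣ) → ℤˣ | IsAccurate ε (g ∘ S.restrict) h} * (t ^ ε) ^ 2 ^ #S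
      = ∑ g : (S → ℤˣ) → ℤˣ with IsAccurate ε (g ∘ S.restrict) h, s ^ (ε * 2 ^ n) := by
        rw [hradius, sum_const, nsmul_eq_mul]
    _ ≤ ∑ g : (S → ℤˣ) → ℤˣ with IsAccurate ε (g ∘ S.restrict) h,
          s ^ hammingDist h (g ∘ S.restrict) := by
        refine sum_le_sum fun g hg => ?_
        rw [← Real.rpow_natCast s]
        exact Real.rpow_le_rpow_of_exponent_ge hs₀ hs₁
          (isAccurate_iff_hammingDist_le.mp (mem_filter.mp hg).2)
    _ ≤ ∑ g : (S → ℤˣ) → ℤˣ, s ^ hammingDist h (g ∘ S.restrict) :=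
        sum_le_sum_of_subset_of_nonneg (filter_subset _ _) fun _ _ _ => by positivity
    _ ≤ (1 + s ^ M) ^ Fintype.card (S → ℤˣ) :=
        sum_pow_hammingDist_comp_le card_filter_restrict_eq h hs₀.le hs₁
    _ = (1 + t) ^ 2 ^ #S := by simp [hs_pow]

open scoped Classical in
theorem card_isAccurate_one_tenth_restrict_le (h : BoolFn n) :
    #{g : (S → ℤˣ) → ℤˣ | IsAccurate (1 / 10) (g ∘ S.restrict) h} ≤ (25 / 18 : ℝ) ^ 2 ^ #S := by
  -- A tenth power close to the optimal parameter `t = ε / (1 - ε) = 1 / 9`.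
  have hcount := card_isAccurate_restrict_mul_le (S := S) h (1 / 10)
    (t := (4 / 5) ^ 10) (by positivity) (by norm_num)
  have hroot : ((4 / 5 : ℝ) ^ 10) ^ (1 / 10 : ℝ) = 4 / 5 := by
    simpa using Real.pow_rpow_inv_natCast (x := 4 / 5) (n := 10) (by norm_num) (by norm_num)
  rw [hroot, ← le_div_iff₀ (by positivity), ← div_pow] at hcount
  refine hcount.trans (pow_le_pow_left₀ (by positivity) ?_ _)
  norm_num

end Junta

/-- For `N = 1` the inequality fails for real `B` and `C`: there integrality forces both to be at
most `1`. -/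
theorem mul_lt_two_thirds_mul_two_pow {B C N : ℕ} (hN : N ≠ 0) (hB : B ≤ (25 / 18 : ℝ) ^ N)
    (hC : C ≤ (9 / 8 : ℝ) ^ N) : (B * C : ℝ) < 2 / 3 * 2 ^ N := by
  rcases (show N = 1 ∨ 2 ≤ N by lia) with rfl | hN₂
  · have hB₁ : B ≤ 1 := by
      have : (B : ℝ) < 2 := by linarith
      exact Nat.le_of_lt_succ (mod_cast this)
    have hC₁ : C ≤ 1 := by
      have : (C : ℝ) < 2 := by linarith
      exact Nat.le_of_lt_succ (mod_cast this)
    calc (B * C : ℝ) ≤ 1 := mod_cast Nat.mul_le_mul hB₁ hC₁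
      _ < 2 / 3 * 2 ^ 1 := by norm_num
  · calc (B * C : ℝ) ≤ (25 / 18) ^ N * (9 / 8) ^ N := by gcongr
      _ = (25 / 32) ^ N * 2 ^ N := by rw [← mul_pow, ← mul_pow]; norm_num
      _ ≤ (25 / 32) ^ 2 * 2 ^ N := by
          gcongr ?_ * _
          exact pow_le_pow_of_le_one (by norm_num) (by norm_num) hN₂
      _ < 2 / 3 * 2 ^ N := by gcongr; norm_num

end JuntaLearning

open JuntaLearning in
theorem mainTheorem4_general {k n : ℕ} (hkn : k ≤ n) {A : Algorithm n}
    (hA : A.IsLearner (1 / 10) {f | IsJunta k f}) :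
    2 ^ k < 50 * (2 * A.qmqCount + A.mqCount) := by
  obtain ⟨S, -, rfl⟩ := Finset.exists_subset_card_eq (s := (Finset.univ : Finset (Fin n)))
    (n := k) (by simpa using hkn)
  have hN : Fintype.card (S → ℤˣ) = 2 ^ S.card := by simp
  by_contra! hD
  have hcount (h : BoolFn n) :=
    Nat.le_floor (card_isAccurate_one_tenth_restrict_le (S := S) h)
  have hmonomials := monomialCount_le_of_fifty_mul_le (hD.trans_eq hN.symm)
  have hlower := hA.two_thirds_mul_le S.restrict (isJunta_comp_restrict le_rfl) hcount
  rw [hN] at hmonomials hlower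
  exact hlower.not_gt
    (mul_lt_two_thirds_mul_two_pow (by positivity) (Nat.floor_le (by positivity)) hmonomials)

theorem mainTheorem4 :
    ∃ c : ℝ, 0 < c ∧ ∀ (k n : ℕ), k ≤ n → ∀ A : JuntaLearning.Algorithm n,
      A.IsLearner (1 / 10) {f | JuntaLearning.IsJunta k f} →
      (A.mqCount : ℝ) ≤ 1 / 101 * 2 ^ k →
      c * 2 ^ k ≤ (A.qmqCount : ℝ) := by
  refine ⟨1 / 200, by norm_num, fun k n hkn A hA hmq => ?_⟩
  have h : (2 : ℝ) ^ k < 50 * (2 * A.qmqCount + A.mqCount) := mod_cast mainTheorem4_general hkn hA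
  linarith [pow_pos (two_pos : (0 : ℝ) < 2) k]
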